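/- Let $\mathfrak S=\{1\}\cup\{2m : m\in\mathbb Z_{>0}\}$. Start with one stick of odd integer length $L\ge 3$. At each level, every living stick, of length $\ell$ say, is cut, independently of all the others, at an integer point $j$ that is uniformly distributed on $\{1,\dots,\ell-1\}$, into two sticks of lengths $j$ and $\ell-j$. A new stick is dead, and is never cut again, if its length lies in $\mathfrak S$ (that is, if its length is $1$ or even); otherwise it is alive. The process ends when all sticks are dead, which happens after at most $L$ levels. Let $X_1,\dots,X_{k_L}$ be the lengths, with multiplicity, of all the dead sticks at the end. For a real base $B>1$ and $x>0$ let $S_B(x)=x\,B^{-\lfloor\log_B x\rfloor}\in[1,B)$ be the significand of $x$, and let $$P_L(s)=\frac{\#\{i\le k_L : S_B(X_i)\le s\}}{k_L}.$$ Then, for every real $B>1$, the collection $\{X_i\}$ converges to strong Benford behavior in base $B$ as $L\to\infty$ through the odd integers; that is, for every $s\in[1,B)$, $$\lim_{L\to\infty}\mathbb E[P_L(s)]=\log_B s\qquad\text{and}\qquad \lim_{L\to\infty}\operatorname{Var}[P_L(s)]=0 .$$ -/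

import Mathlib

open Filter Topology MeasureTheory ProbabilityTheory

noncomputable section

/-! ### Strong Benford behavior -/

/-- The significand of `x > 0` in base `B > 1`: the number `S ∈ [1, B)` such that
`x = S * B ^ k` with `k = ⌊log_B x⌋`. -/
def significand (B x : ℝ) : ℝ := x / B ^ ⌊Real.logb B x⌋

open Classical in
/-- The proportion `P(s)` of the members of a finite collection (counted with multiplicity)
whose significand in base `B` is at most `s`. -/
def significandProportion (B s : ℝ) (xs : List ℝ) : ℝ :=
  (xs.countP fun x => decide (significand B x ≤ s) : ℝ) / (xs.length : ℝ)

/-- A family of random finite collections `X i` of positive numbers, each living on its own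
probability space `(Ω i, μ i)`, converges along the filter `l` to strong Benford behavior in
base `B`: for every `s ∈ [1, B)` one has `𝔼[P(s)] → log_B s` and `Var[P(s)] → 0`. -/
def ConvergesToStrongBenford {ι : Type*} (l : Filter ι) {Ω : ι → Type*}
    [∀ i, MeasurableSpace (Ω i)] (μ : ∀ i, Measure (Ω i)) (X : ∀ i, Ω i → List ℝ)
    (B : ℝ) : Prop :=
  ∀ s ∈ Set.Ico 1 B,
    Tendsto (fun i => ∫ ω, significandProportion B s (X i ω) ∂(μ i)) l (𝓝 (Real.logb B s)) ∧
    Tendsto (fun i => variance (fun ω => significandProportion B s (X i ω)) (μ i)) l (𝓝 0)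

/-! ### Discrete fragmentation with a stopping set -/

open Classical in
/-- What becomes of one stick of length `n` in one level, for the stopping set `S`: a dead stick
(`n ∈ S`) stays as it is, a living one is cut at a uniformly random point of `{1, …, n - 1}`.
(A stick of length less than `2` has no cutting point and stays as it is.) -/
def breakStick (S : Set ℕ) (n : ℕ) : PMF (List ℕ) :=
  if h : n ∈ S ∨ n < 2 then PMF.pure [n]
  else (PMF.uniformOfFinset (Finset.Icc 1 (n - 1))
    (Finset.nonempty_Icc.2 (by rw [not_or] at h; omega))).map fun j => [j, n - j]

/-- One level: all the sticks of the collection are broken independently. -/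
def levelStep (S : Set ℕ) : List ℕ → PMF (List ℕ)
  | [] => PMF.pure []
  | n :: ns => (breakStick S n).bind fun a => (levelStep S ns).map fun b => a ++ b

/-- The law of the collection of all sticks (dead or alive) after `N` levels, for a starting stick
of length `L`. -/
def levelLaw (S : Set ℕ) (L : ℕ) : ℕ → PMF (List ℕ)
  | 0 => PMF.pure [L]
  | N + 1 => (levelLaw S L N).bind (levelStep S)

/-- The law of the collection of all sticks when the process has ended. Every level shortens every
living stick, so the process is over after at most `L` levels; see
`mem_of_mem_support_finalLaw` and `levelLaw_eq_finalLaw`. -/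
def finalLaw (S : Set ℕ) (L : ℕ) : PMF (List ℕ) := levelLaw S L L

/-- The stopping set: a stick dies when its length is `1` or even. -/
def oneOrEven : Set ℕ := {1} ∪ {n | ∃ m : ℕ, 0 < m ∧ n = 2 * m}

/-- All sets of finite collections are events. -/
instance instMeasurableSpaceListNat : MeasurableSpace (List ℕ) := ⊤

/-! ### The process ends -/

theorem mem_breakStick {S : Set ℕ} {n : ℕ} {a : List ℕ} (ha : a ∈ (breakStick S n).support)
    {x : ℕ} (hx : x ∈ a) (hn : 0 < n) :
    0 < x ∧ ((n ∈ S ∨ n < 2) ∧ x = n ∨ x < n) := by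
  unfold breakStick at ha
  split_ifs at ha with h
  · simp only [PMF.support_pure, Set.mem_singleton_iff] at ha
    subst ha
    simp only [List.mem_singleton] at hx
    subst hx
    exact ⟨hn, Or.inl ⟨h, rfl⟩⟩
  · simp only [PMF.support_map, Set.mem_image, PMF.mem_support_uniformOfFinset_iff,
      Finset.mem_Icc] at ha
    obtain ⟨j, hj, rfl⟩ := ha
    simp only [List.mem_cons, List.not_mem_nil, or_false] at hx
    omega

theorem mem_levelStep {S : Set ℕ} {x : ℕ} :
    ∀ {ns a : List ℕ}, a ∈ (levelStep S ns).support → x ∈ a →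
      ∃ n ∈ ns, ∃ b ∈ (breakStick S n).support, x ∈ b
  | [], a, ha, hx => by
      simp only [levelStep, PMF.support_pure, Set.mem_singleton_iff] at ha
      subst ha
      simp at hx
  | n :: ns, a, ha, hx => by
      simp only [levelStep, PMF.mem_support_bind_iff, PMF.support_map, Set.mem_image] at ha
      obtain ⟨c, hc, d, hd, rfl⟩ := ha
      rcases List.mem_append.1 hx with hx | hx
      · exact ⟨n, by simp, c, hc, hx⟩
      · obtain ⟨m, hm, b, hb, hxb⟩ := mem_levelStep hd hx
        exact ⟨m, by simp [hm], b, hb, hxb⟩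

/-- After `N` levels a stick that is still alive has length at most `L - N`. -/
theorem mem_levelLaw {S : Set ℕ} (h1 : 1 ∈ S) {L : ℕ} (hL : 0 < L) (N : ℕ) :
    ∀ a ∈ (levelLaw S L N).support, ∀ x ∈ a, 0 < x ∧ (x ∈ S ∨ x + N ≤ L) := by
  induction N with
  | zero =>
    intro a ha x hx
    simp only [levelLaw, PMF.support_pure, Set.mem_singleton_iff] at ha
    subst ha
    simp only [List.mem_singleton] at hx
    subst hx
    exact ⟨hL, Or.inr le_rfl⟩
  | succ N ih =>
    intro a ha x hx
    simp only [levelLaw, PMF.mem_support_bind_iff] at ha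
    obtain ⟨c, hc, ha⟩ := ha
    obtain ⟨n, hn, b, hb, hxb⟩ := mem_levelStep ha hx
    obtain ⟨hn0, hn1⟩ := ih c hc n hn
    by_cases hnS : n ∈ S ∨ n < 2
    · have hnS' : n ∈ S := by
        rcases hnS with h | h
        · exact h
        · have : n = 1 := by omega
          exact this ▸ h1
      have : breakStick S n = PMF.pure [n] := by simp [breakStick, hnS']
      rw [this] at hb
      simp only [PMF.support_pure, Set.mem_singleton_iff] at hb
      subst hb
      simp only [List.mem_singleton] at hxb
      subst hxb
      exact ⟨hn0, Or.inl hnS'⟩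
    · obtain ⟨hx0, h⟩ := mem_breakStick hb hxb hn0
      refine ⟨hx0, Or.inr ?_⟩
      rcases h with h | h
      · exact absurd h.1 hnS
      · rw [not_or] at hnS
        rcases hn1 with h' | h'
        · exact absurd h' hnS.1
        · omega

theorem mem_of_mem_support_finalLaw {S : Set ℕ} (h1 : 1 ∈ S) {L : ℕ} (hL : 0 < L) :
    ∀ a ∈ (finalLaw S L).support, ∀ x ∈ a, x ∈ S := by
  intro a ha x hx
  obtain ⟨h0, h | h⟩ := mem_levelLaw h1 hL L a ha x hx
  · exact h
  · omega

theorem levelStep_eq_pure {S : Set ℕ} :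
    ∀ {ns : List ℕ}, (∀ n ∈ ns, n ∈ S) → levelStep S ns = PMF.pure ns
  | [], _ => rfl
  | n :: ns, h => by
      have hn : breakStick S n = PMF.pure [n] := by
        simp [breakStick, h n (by simp)]
      rw [levelStep, hn, PMF.pure_bind, levelStep_eq_pure fun m hm => h m (by simp [hm]),
        PMF.pure_map]
      rfl

/-- Once the process has ended, nothing changes any more. -/
theorem levelLaw_eq_finalLaw {S : Set ℕ} (h1 : 1 ∈ S) {L : ℕ} (hL : 0 < L) (N : ℕ) :
    levelLaw S L (L + N) = finalLaw S L := by
  induction N with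
  | zero => rfl
  | succ N ih =>
    rw [← Nat.add_assoc, levelLaw, ih]
    ext b
    rw [PMF.bind_apply]
    have : ∀ a, finalLaw S L a * levelStep S a b = finalLaw S L a * PMF.pure a b := by
      intro a
      by_cases ha : a ∈ (finalLaw S L).support
      · rw [levelStep_eq_pure (mem_of_mem_support_finalLaw h1 hL a ha)]
      · rw [PMF.mem_support_iff, not_not] at ha
        simp [ha]
    simp_rw [this]
    rw [← PMF.bind_apply, PMF.bind_pure]

end

/-! An odd stick splits into one odd and one even piece, and the even one dies at once. So at most
one stick is alive at any level: from length `2 * n + 1` the chain moves to `2 * m + 1` with `m`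
uniform below `n`, shedding `2 * (n - m)`. `integral_runLevels` reduces the process to this chain.

Conditioning on the first cut shows that length `2 * d`, for `1 ≤ d ≤ n`, occurs `1 / d` times on
average (`chainExp_sum`). The number of sticks therefore has mean `1 + H`, with `H` the harmonic
sum, and variance at most `H`. For `f` the centred indicator of a small significand, the expected
sum of `f` is a logarithmic sum of `f (2 * d) / d`. It stays bounded
(`exists_abs_sum_fractIndicator_div_le`): the `1 / d` weights approximate `d log`, and a centred
periodic function of `log` has a bounded primitive. Bounded first moments make the second moment of
the sum only `O(H)`.

Dividing by a count concentrated near `1 + H`, the mean square of the average of `f` is `O(1 / H)`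
(`chainExp_average_sq_le`). This controls both bias and variance, and `H` diverges. -/

noncomputable section

/-! ### Expectations along the chain of living sticks -/

/-- The expectation of `φ`, evaluated at the final collection of sticks, when the process starts
from a stick of length `2 * n + 1`: the odd piece of the first cut has length `2 * m + 1` with `m`
uniform in `{0, …, n - 1}`, and the even one has length `2 * (n - m)`. -/
def chainExp : ℕ → (Multiset ℕ → ℝ) → ℝ
  | 0, φ => φ {1}
  | n + 1, φ => (∑ m : Fin (n + 1), chainExp m fun s => φ ((2 * (n + 1 - m)) ::ₘ s)) / (n + 1)
termination_by n => n

@[simp] theorem chainExp_zero (φ : Multiset ℕ → ℝ) : chainExp 0 φ = φ {1} := by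
  rw [chainExp]

theorem chainExp_succ (n : ℕ) (φ : Multiset ℕ → ℝ) :
    chainExp (n + 1) φ =
      (∑ m ∈ Finset.range (n + 1), chainExp m fun s => φ ((2 * (n + 1 - m)) ::ₘ s)) / (n + 1) := by
  rw [chainExp, Finset.sum_range]

theorem mul_chainExp {n : ℕ} (hn : n ≠ 0) (φ : Multiset ℕ → ℝ) :
    n * chainExp n φ = ∑ m ∈ Finset.range n, chainExp m fun s => φ ((2 * (n - m)) ::ₘ s) := by
  obtain ⟨n, rfl⟩ := Nat.exists_eq_succ_of_ne_zero hn
  rw [Nat.succ_eq_add_one, chainExp_succ]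
  push_cast
  field_simp

theorem chainExp_const (c : ℝ) (n : ℕ) : (chainExp n fun _ => c) = c := by
  induction n using Nat.strong_induction_on with
  | _ n ih =>
    rcases n with _ | n
    · simp
    · rw [chainExp_succ, Finset.sum_congr rfl fun m hm => ih m (Finset.mem_range.1 hm)]
      simp only [Finset.sum_const, Finset.card_range, nsmul_eq_mul]
      push_cast
      field_simp

theorem chainExp_add (n : ℕ) (φ ψ : Multiset ℕ → ℝ) :
    (chainExp n fun s => φ s + ψ s) = chainExp n φ + chainExp n ψ := by
  induction n using Nat.strong_induction_on generalizing φ ψ with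
  | _ n ih =>
    rcases n with _ | n
    · simp
    · simp only [chainExp_succ]
      rw [Finset.sum_congr rfl fun m hm => ih m (Finset.mem_range.1 hm) _ _,
        Finset.sum_add_distrib, add_div]

theorem chainExp_const_mul (n : ℕ) (c : ℝ) (φ : Multiset ℕ → ℝ) :
    (chainExp n fun s => c * φ s) = c * chainExp n φ := by
  induction n using Nat.strong_induction_on generalizing φ with
  | _ n ih =>
    rcases n with _ | n
    · simp
    · simp only [chainExp_succ]
      rw [Finset.sum_congr rfl fun m hm => ih m (Finset.mem_range.1 hm) _,
        ← Finset.mul_sum, mul_div_assoc]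

/-- The final collection is never empty. The exception matters for averages, where division by a
zero cardinality would break the centring identity `sum_map_sub_div_card`. -/
theorem chainExp_congr (n : ℕ) {φ ψ : Multiset ℕ → ℝ} (h : ∀ s, s ≠ 0 → φ s = ψ s) :
    chainExp n φ = chainExp n ψ := by
  rcases n with _ | n
  · simpa using h {1} (Multiset.singleton_ne_zero 1)
  · simp only [chainExp_succ, h _ Multiset.cons_ne_zero]

theorem chainExp_mono (n : ℕ) {φ ψ : Multiset ℕ → ℝ} (h : ∀ s, φ s ≤ ψ s) :
    chainExp n φ ≤ chainExp n ψ := by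
  induction n using Nat.strong_induction_on generalizing φ ψ with
  | _ n ih =>
    rcases n with _ | n
    · simpa using h {1}
    · simp only [chainExp_succ]
      gcongr with m hm
      exact ih m (Finset.mem_range.1 hm) fun s => h _

/-- `1 + 1 / 2 + ⋯ + 1 / n` as a real number. -/
def harmonicSum (n : ℕ) : ℝ := ∑ d ∈ Finset.range n, 1 / ((d : ℝ) + 1)

theorem harmonicSum_succ (n : ℕ) : harmonicSum (n + 1) = harmonicSum n + 1 / ((n : ℝ) + 1) :=
  Finset.sum_range_succ _ _

theorem harmonicSum_nonneg (n : ℕ) : 0 ≤ harmonicSum n :=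
  Finset.sum_nonneg fun _ _ => by positivity

theorem sum_harmonicSum (n : ℕ) :
    ∑ m ∈ Finset.range n, harmonicSum m = n * harmonicSum n - n := by
  induction n with
  | zero => simp
  | succ n ih =>
    rw [Finset.sum_range_succ, ih, harmonicSum_succ]
    push_cast
    field_simp
    ring

/-- The summand is the second-moment bound of `chainExp_card_sq_le`; this evaluation closes the
induction there with slack `harmonicSum n`. -/
theorem sum_harmonicSum_sq (n : ℕ) :
    ∑ m ∈ Finset.range n, ((1 + harmonicSum m) ^ 2 + harmonicSum m) =
      n * (harmonicSum n ^ 2 + harmonicSum n) - harmonicSum n := by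
  induction n with
  | zero => simp [harmonicSum]
  | succ n ih =>
    rw [Finset.sum_range_succ, ih, harmonicSum_succ]
    push_cast
    field_simp
    ring

/-- Subtracting the recursions at `n + 1` and `n` leaves `(n + 1) * (a (n + 1) - a n) = g n`. -/
theorem eq_add_sum_of_mul_eq_sum {a g : ℕ → ℝ}
    (h : ∀ n, n ≠ 0 → n * a n = ∑ d ∈ Finset.range n, g d + ∑ m ∈ Finset.range n, a m) (n : ℕ) :
    a n = a 0 + ∑ d ∈ Finset.range n, g d / ((d : ℝ) + 1) := by
  induction n with
  | zero => simp
  | succ n ih =>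
    have h0 : n * a n = ∑ d ∈ Finset.range n, g d + ∑ m ∈ Finset.range n, a m := by
      rcases eq_or_ne n 0 with rfl | hn
      · simp
      · exact h n hn
    have h1 := h (n + 1) n.succ_ne_zero
    rw [Finset.sum_range_succ, Finset.sum_range_succ] at h1
    rw [Finset.sum_range_succ, ← add_assoc, ← ih]
    push_cast at h1
    field_simp
    linarith

/-- Inequalities cannot be subtracted as above. Instead the right-hand side solves the recursion
with equality, by `sum_harmonicSum`, and dominates by strong induction. -/
theorem le_add_mul_harmonicSum {v : ℕ → ℝ} {C : ℝ}
    (h : ∀ n, n ≠ 0 → n * v n ≤ n * C + ∑ m ∈ Finset.range n, v m) (n : ℕ) :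
    v n ≤ v 0 + C * harmonicSum n := by
  induction n using Nat.strong_induction_on with
  | _ n ih =>
    rcases eq_or_ne n 0 with rfl | hn
    · simp [harmonicSum]
    · have h2 : ∑ m ∈ Finset.range n, v m ≤ ∑ m ∈ Finset.range n, (v 0 + C * harmonicSum m) :=
        Finset.sum_le_sum fun m hm => ih m (Finset.mem_range.1 hm)
      rw [Finset.sum_add_distrib, ← Finset.mul_sum, sum_harmonicSum] at h2
      simp only [Finset.sum_const, Finset.card_range, nsmul_eq_mul] at h2
      have hn' : (0 : ℝ) < n := by positivity
      refine le_of_mul_le_mul_left ?_ hn'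
      linarith [h n hn]

theorem chainExp_sum (f : ℕ → ℝ) (n : ℕ) :
    (chainExp n fun s => (s.map f).sum) =
      f 1 + ∑ d ∈ Finset.range n, f (2 * (d + 1)) / ((d : ℝ) + 1) := by
  rw [eq_add_sum_of_mul_eq_sum (a := fun n => chainExp n fun s => (s.map f).sum)
    (g := fun d => f (2 * (d + 1))) _ n]
  · simp
  · intro n hn
    rw [mul_chainExp hn, ← Finset.sum_range_reflect (fun d => f (2 * (d + 1))),
      ← Finset.sum_add_distrib]
    refine Finset.sum_congr rfl fun m hm => ?_
    have hm := Finset.mem_range.1 hm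
    simp only [Multiset.map_cons, Multiset.sum_cons]
    rw [chainExp_add, chainExp_const, show n - 1 - m + 1 = n - m by omega]

theorem mul_chainExp_sum_sq (f : ℕ → ℝ) {n : ℕ} (hn : n ≠ 0) :
    (n * chainExp n fun s => (s.map f).sum ^ 2) =
      ∑ m ∈ Finset.range n, (f (2 * (n - m)) ^ 2 +
        2 * f (2 * (n - m)) * (chainExp m fun s => (s.map f).sum) +
        chainExp m fun s => (s.map f).sum ^ 2) := by
  rw [mul_chainExp hn]
  refine Finset.sum_congr rfl fun m hm => ?_
  simp only [Multiset.map_cons, Multiset.sum_cons, add_sq]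
  rw [chainExp_add, chainExp_add, chainExp_const, chainExp_const_mul]

/-- Each cut contributes a square, at most `1`, and a cross term, at most `2 * C` because the
remaining chain has bounded mean. Growth is thus linear in `harmonicSum n`, not quadratic. -/
theorem chainExp_sum_sq_le {f : ℕ → ℝ} {C : ℝ} (hf : ∀ x, |f x| ≤ 1)
    (hC : ∀ n, |chainExp n fun s => (s.map f).sum| ≤ C) (n : ℕ) :
    (chainExp n fun s => (s.map f).sum ^ 2) ≤ 1 + (1 + 2 * C) * harmonicSum n := by
  have hf2 : ∀ x, f x ^ 2 ≤ 1 := fun x => by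
    rw [← sq_abs]; exact pow_le_one₀ (abs_nonneg _) (hf x)
  refine (le_add_mul_harmonicSum (C := 1 + 2 * C) (v := fun n => chainExp n fun s =>
    (s.map f).sum ^ 2) (fun n hn => ?_) n).trans ?_
  · rw [mul_chainExp_sum_sq f hn, Finset.sum_add_distrib]
    gcongr
    refine (Finset.sum_le_card_nsmul _ _ (1 + 2 * C) fun m _ => ?_).trans
      (by simp [mul_add])
    have h1 : f (2 * (n - m)) * (chainExp m fun s => (s.map f).sum) ≤ 1 * C := by
      refine (le_abs_self _).trans ?_
      rw [abs_mul]
      exact mul_le_mul (hf _) (hC m) (abs_nonneg _) zero_le_one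
    linarith [hf2 (2 * (n - m))]
  · simpa using hf2 1

theorem chainExp_card (n : ℕ) :
    (chainExp n fun s => (s.card : ℝ)) = 1 + harmonicSum n := by
  simpa [harmonicSum] using chainExp_sum (fun _ => 1) n

theorem chainExp_card_sq_le (n : ℕ) :
    (chainExp n fun s => (s.card : ℝ) ^ 2) ≤ (1 + harmonicSum n) ^ 2 + harmonicSum n := by
  induction n using Nat.strong_induction_on with
  | _ n ih =>
    rcases eq_or_ne n 0 with rfl | hn
    · simp [harmonicSum]
    · have h1 := mul_chainExp_sum_sq (fun _ => 1) hn
      simp only [Multiset.map_const', Multiset.sum_replicate, nsmul_eq_mul, mul_one,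
        chainExp_card, one_pow, Finset.sum_add_distrib, ← Finset.mul_sum, sum_harmonicSum,
        Finset.sum_const, Finset.card_range] at h1
      have h2 := Finset.sum_le_sum fun m hm => ih m (Finset.mem_range.1 hm)
      rw [sum_harmonicSum_sq] at h2
      have hn' : (0 : ℝ) < n := by positivity
      refine le_of_mul_le_mul_left ?_ hn'
      rw [h1]
      linarith [harmonicSum_nonneg n]

theorem chainExp_card_sub_sq_le (n : ℕ) :
    (chainExp n fun s => ((s.card : ℝ) - (1 + harmonicSum n)) ^ 2) ≤ harmonicSum n := by
  have h : (fun s : Multiset ℕ => ((s.card : ℝ) - (1 + harmonicSum n)) ^ 2) = fun s =>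
      (s.card : ℝ) ^ 2 + (-(2 * (1 + harmonicSum n)) * (s.card : ℝ) + (1 + harmonicSum n) ^ 2) := by
    funext s; ring
  rw [h, chainExp_add, chainExp_add, chainExp_const_mul, chainExp_const, chainExp_card]
  nlinarith [chainExp_card_sq_le n]

theorem abs_sum_map_le_card {f : ℕ → ℝ} (hf : ∀ x, |f x| ≤ 1) (s : Multiset ℕ) :
    |(s.map f).sum| ≤ s.card := by
  induction s using Multiset.induction_on with
  | empty => simp
  | cons a s ih =>
    simp only [Multiset.map_cons, Multiset.sum_cons, Multiset.card_cons]
    push_cast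
    linarith [abs_add_le (f a) (s.map f).sum, hf a]

theorem abs_sum_map_div_card_le {f : ℕ → ℝ} (hf : ∀ x, |f x| ≤ 1) (s : Multiset ℕ) :
    |(s.map f).sum / s.card| ≤ 1 := by
  rw [abs_div, Nat.abs_cast]
  exact div_le_one_of_le₀ (abs_sum_map_le_card hf s) (Nat.cast_nonneg _)

/-- The mean square of the average of `f` over the final collection tends to zero when the
expected sums are bounded. -/
theorem chainExp_average_sq_le {f : ℕ → ℝ} {C : ℝ} (hf : ∀ x, |f x| ≤ 1)
    (hC : ∀ n, |chainExp n fun s => (s.map f).sum| ≤ C) (n : ℕ) :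
    (chainExp n fun s => ((s.map f).sum / s.card) ^ 2) ≤ (4 + 4 * C) / (1 + harmonicSum n) := by
  set H := harmonicSum n with hH
  have hH0 : 0 ≤ H := harmonicSum_nonneg n
  have hC0 : 0 ≤ C := (abs_nonneg _).trans (hC 0)
  -- With `x` the average and `k` the cardinality, `(1 + H) * x = x * k - x * (k - (1 + H))`. Then
  -- `(a - b) ^ 2 ≤ 2 * a ^ 2 + 2 * b ^ 2` and `x ^ 2 ≤ 1` give the bound.
  have key : ∀ s : Multiset ℕ, (1 + H) ^ 2 * ((s.map f).sum / s.card) ^ 2 ≤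
      2 * (s.map f).sum ^ 2 + 2 * ((s.card : ℝ) - (1 + H)) ^ 2 := by
    intro s
    set x := (s.map f).sum / (s.card : ℝ) with hx
    have hx1 : x ^ 2 ≤ 1 := by
      rw [← sq_abs]; exact pow_le_one₀ (abs_nonneg _) (abs_sum_map_div_card_le hf s)
    have hxk : (s.map f).sum = x * s.card := by
      rcases eq_or_ne s 0 with rfl | hs
      · simp
      · have : (s.card : ℝ) ≠ 0 := by simpa using hs
        rw [hx]; field_simp
    rw [hxk]
    set k := (s.card : ℝ)
    nlinarith [sq_nonneg (x * k + x * (k - (1 + H))),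
      mul_nonneg (sub_nonneg.2 hx1) (sq_nonneg (k - (1 + H)))]
  have h := chainExp_mono n key
  rw [chainExp_const_mul, chainExp_add, chainExp_const_mul, chainExp_const_mul] at h
  have h1 := chainExp_sum_sq_le hf hC n
  have h2 := chainExp_card_sub_sq_le n
  rw [← hH] at h1 h2
  rw [le_div_iff₀ (by positivity)]
  refine le_of_mul_le_mul_left ?_ (show 0 < 1 + H by positivity)
  nlinarith

/-! ### Logarithmic averages of significand indicators -/

/-- The primitive of the indicator function of `{u | fract u ≤ p}`. -/
def fractPrimitive (p u : ℝ) : ℝ := p * ⌊u⌋ + min (Int.fract u) p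

open Classical in
/-- The indicator function of `{u | fract u ≤ p}`. -/
def fractIndicator (p u : ℝ) : ℝ := if Int.fract u ≤ p then 1 else 0

/-- The primitive gains exactly `p` per unit period, so removing the linear trend leaves a bounded
periodic function. -/
theorem abs_fractPrimitive_sub_le {p : ℝ} (h0 : 0 ≤ p) (h1 : p < 1) (u : ℝ) :
    |fractPrimitive p u - p * u| ≤ 1 := by
  have hf := Int.fract_nonneg u
  have hf1 := Int.fract_lt_one u
  have h : fractPrimitive p u - p * u = min (Int.fract u) p - p * Int.fract u := by
    rw [fractPrimitive]; linear_combination -p * Int.self_sub_floor u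
  rw [h, abs_le]
  have := min_le_left (Int.fract u) p
  have : 0 ≤ min (Int.fract u) p := le_min hf h0
  constructor <;> nlinarith [mul_nonneg h0 hf]

/-- The primitive has slope `0` or `1`, hence is monotone and 1-Lipschitz. -/
theorem fractPrimitive_sub_mem {p u v : ℝ} (h0 : 0 ≤ p) (h1 : p < 1) (huv : u ≤ v) :
    0 ≤ fractPrimitive p v - fractPrimitive p u ∧
      fractPrimitive p v - fractPrimitive p u ≤ v - u := by
  have hfl : (⌊u⌋ : ℤ) ≤ ⌊v⌋ := Int.floor_le_floor huv
  have hu := Int.floor_add_fract u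
  have hv := Int.floor_add_fract v
  have hfu := Int.fract_nonneg u
  have hfu1 := Int.fract_lt_one u
  have hfv := Int.fract_nonneg v
  have hfv1 := Int.fract_lt_one v
  unfold fractPrimitive
  rcases hfl.eq_or_lt with h | h
  · rw [← h] at hv ⊢
    constructor <;> rcases min_cases (Int.fract u) p with h3 | h3 <;>
      rcases min_cases (Int.fract v) p with h4 | h4 <;> linarith
  · have h' : (⌊u⌋ : ℝ) + 1 ≤ ⌊v⌋ := by exact_mod_cast h
    have hm : p ≤ p * ((⌊v⌋ : ℝ) - ⌊u⌋) := by nlinarith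
    have hm' : 0 ≤ (1 - p) * ((⌊v⌋ : ℝ) - ⌊u⌋ - 1) := by
      apply mul_nonneg <;> linarith
    constructor <;> rcases min_cases (Int.fract u) p with h3 | h3 <;>
      rcases min_cases (Int.fract v) p with h4 | h4 <;> nlinarith

theorem fractIndicator_mem (p u : ℝ) : 0 ≤ fractIndicator p u ∧ fractIndicator p u ≤ 1 := by
  unfold fractIndicator; split_ifs <;> norm_num

open Classical in
/-- The indicator times the length of an interval is the increment of the primitive, unless the
interval contains a jump of the indicator. -/
theorem abs_fractIndicator_mul_sub_le {p u v : ℝ} (h0 : 0 ≤ p) (h1 : p < 1) (huv : u ≤ v) :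
    |fractIndicator p u * (v - u) - (fractPrimitive p v - fractPrimitive p u)| ≤
      (v - u) * ((if ⌊u⌋ < ⌊v⌋ then 1 else 0) + if ⌈u - p⌉ < ⌈v - p⌉ then 1 else 0) := by
  obtain ⟨ha, hb⟩ := fractPrimitive_sub_mem h0 h1 huv
  obtain ⟨hc, hd⟩ := fractIndicator_mem p u
  have hvu : 0 ≤ v - u := sub_nonneg.2 huv
  have hcross : |fractIndicator p u * (v - u) - (fractPrimitive p v - fractPrimitive p u)| ≤
      v - u := by
    rw [abs_le]; constructor <;> nlinarith
  by_cases hA : ⌊u⌋ < ⌊v⌋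
  · rw [if_pos hA]
    refine hcross.trans ?_
    split_ifs <;> nlinarith
  -- The indicator lives on the intervals `[k, k + p]`. Entry at `k` is seen by the floor; exit is
  -- seen by a ceiling because the right endpoint is included.
  by_cases hB : ⌈u - p⌉ < ⌈v - p⌉
  · rw [if_neg hA, if_pos hB]
    simpa using hcross
  rw [if_neg hA, if_neg hB]
  have hfl : ⌊v⌋ = ⌊u⌋ := le_antisymm (not_lt.1 hA) (Int.floor_le_floor huv)
  have hu := Int.floor_add_fract u
  have hv := Int.floor_add_fract v
  rw [hfl] at hv
  suffices fractIndicator p u * (v - u) - (fractPrimitive p v - fractPrimitive p u) = 0 by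
    simp [this]
  unfold fractIndicator fractPrimitive
  rw [hfl]
  split_ifs with h
  · have h2 : Int.fract v ≤ p := by
      have h3 : ⌈u - p⌉ ≤ ⌊u⌋ := Int.ceil_le.2 (by linarith)
      have h4 : v - p ≤ ⌊u⌋ := Int.ceil_le.1 ((not_lt.1 hB).trans h3)
      linarith
    rw [min_eq_left h, min_eq_left h2]; linarith
  · have h := (not_le.1 h).le
    rw [min_eq_right h, min_eq_right (by linarith)]; ring

open Classical in
/-- The jumps of an integer-valued sequence, weighted with powers of `1 / B`, are controlled by a
telescoping difference. -/
theorem zpow_neg_mul_jump_le {B : ℝ} (hB : 1 < B) {j k : ℤ} (hjk : j ≤ k) :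
    (B ^ (-j) * if j < k then 1 else 0) ≤ B / (B - 1) * (B ^ (-j) - B ^ (-k)) := by
  have hB0 : 0 < B := by linarith
  have hB1 : 0 < B - 1 := by linarith
  rcases hjk.eq_or_lt with rfl | h
  · simp
  · rw [if_pos h, mul_one, div_mul_eq_mul_div, le_div_iff₀ hB1]
    -- A jump forces `k ≥ j + 1`, so the power drops by at least the fraction `1 - 1 / B`; hence the
    -- constant `B / (B - 1)`.
    have h1 : B * B ^ (-k) ≤ B ^ (-j) := by
      rw [← zpow_one_add₀ hB0.ne']
      exact zpow_le_zpow_right₀ hB.le (by omega)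
    linarith

theorem log_succ_sub_log_mem {d : ℝ} (hd : 0 < d) :
    1 / (d + 1) ≤ Real.log (d + 1) - Real.log d ∧ Real.log (d + 1) - Real.log d ≤ 1 / d := by
  rw [← Real.log_div (by positivity) hd.ne']
  constructor
  · have := Real.one_sub_inv_le_log_of_pos (show 0 < (d + 1) / d by positivity)
    refine le_trans (le_of_eq ?_) this
    field_simp; ring
  · refine (Real.log_le_sub_one_of_pos (by positivity)).trans (le_of_eq ?_)
    field_simp; ring

/-- One step of the comparison of `(fractIndicator p u - p) / d`, for `u = logb B (2 * d)`, with
a telescoping difference. -/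
theorem exists_abs_fractIndicator_div_le {B p : ℝ} (hB : 1 < B) (h0 : 0 ≤ p) (h1 : p < 1) :
    ∃ C : ℝ, 0 ≤ C ∧ ∀ d : ℝ, 0 < d →
      |(fractIndicator p (Real.logb B (2 * d)) - p) / d - Real.log B *
        ((fractPrimitive p (Real.logb B (2 * (d + 1))) - p * Real.logb B (2 * (d + 1))) -
          (fractPrimitive p (Real.logb B (2 * d)) - p * Real.logb B (2 * d)))| ≤
      C * ((B ^ (-⌊Real.logb B (2 * d)⌋) - B ^ (-⌊Real.logb B (2 * (d + 1))⌋)) +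
        (B ^ (-⌈Real.logb B (2 * d) - p⌉) - B ^ (-⌈Real.logb B (2 * (d + 1)) - p⌉))) +
        (1 / d - 1 / (d + 1)) := by
  classical
  have hB0 : 0 < B := by linarith
  have hB1 : 0 < B - 1 := by linarith
  -- The factor `2` comes from `1 / d = 2 * B ^ (-u)`, `B` from rounding the exponent to an integer,
  -- and `B / (B - 1)` from `zpow_neg_mul_jump_le`.
  refine ⟨2 * B * (B / (B - 1)), by positivity, fun d hd => ?_⟩
  set u := Real.logb B (2 * d) with hu
  set v := Real.logb B (2 * (d + 1)) with hv
  have hlB : 0 < Real.log B := Real.log_pos hB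
  have huv : u ≤ v := Real.logb_le_logb_of_le hB (by positivity) (by linarith)
  have hdiff : Real.log B * (v - u) = Real.log (d + 1) - Real.log d := by
    rw [hu, hv, Real.logb, Real.logb, Real.log_mul two_ne_zero hd.ne',
      Real.log_mul two_ne_zero (by positivity)]
    field_simp; ring
  obtain ⟨hl1, hl2⟩ := log_succ_sub_log_mem hd
  rw [← hdiff] at hl1 hl2
  have hstep := abs_fractIndicator_mul_sub_le h0 h1 huv
  have hBu : B ^ u = 2 * d := Real.rpow_logb hB0 hB.ne' (by positivity)
  have hd1 : 1 / d = 2 * B ^ (-u) := by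
    rw [Real.rpow_neg hB0.le, hBu]; field_simp
  have hfl : B ^ (-u) ≤ B * B ^ (-⌊u⌋) := by
    rw [← zpow_one_add₀ hB0.ne', ← Real.rpow_intCast]
    refine Real.rpow_le_rpow_of_exponent_le hB.le ?_
    push_cast
    linarith [Int.floor_le u]
  have hce : B ^ (-u) ≤ B * B ^ (-⌈u - p⌉) := by
    rw [← zpow_one_add₀ hB0.ne', ← Real.rpow_intCast]
    refine Real.rpow_le_rpow_of_exponent_le hB.le ?_
    push_cast
    linarith [Int.ceil_lt_add_one (u - p)]
  have hj1 := zpow_neg_mul_jump_le hB (Int.floor_le_floor huv)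
  have hj2 := zpow_neg_mul_jump_le hB (Int.ceil_le_ceil (sub_le_sub_right huv p))
  obtain ⟨hi0, hi1⟩ := fractIndicator_mem p u
  set e := fractIndicator p u
  set x : ℝ := if ⌊u⌋ < ⌊v⌋ then 1 else 0 with hx
  set y : ℝ := if ⌈u - p⌉ < ⌈v - p⌉ then 1 else 0 with hy
  have hx0 : 0 ≤ x := by rw [hx]; split_ifs <;> norm_num
  have hy0 : 0 ≤ y := by rw [hy]; split_ifs <;> norm_num
  -- Cost of replacing `1 / d` by the logarithmic increment, which lies between `1 / (d + 1)` and `1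
  -- / d`.
  have hA : |(e - p) / d - (e - p) * (Real.log B * (v - u))| ≤ 1 / d - 1 / (d + 1) := by
    rw [div_eq_mul_one_div, ← mul_sub, abs_mul, abs_of_nonneg (sub_nonneg.2 hl2)]
    have : |e - p| ≤ 1 := abs_le.2 ⟨by linarith, by linarith⟩
    nlinarith [mul_nonneg (sub_nonneg.2 this) (sub_nonneg.2 hl2)]
  have hD : |Real.log B * (e * (v - u) - (fractPrimitive p v - fractPrimitive p u))| ≤
      2 * B * (B / (B - 1)) * ((B ^ (-⌊u⌋) - B ^ (-⌊v⌋)) + (B ^ (-⌈u - p⌉) - B ^ (-⌈v - p⌉))) := by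
    rw [abs_mul, abs_of_pos hlB]
    calc _ ≤ Real.log B * ((v - u) * (x + y)) := by gcongr
      _ = Real.log B * (v - u) * (x + y) := by ring
      _ ≤ 2 * B ^ (-u) * (x + y) := by rw [← hd1]; gcongr
      _ = 2 * (B ^ (-u) * x + B ^ (-u) * y) := by ring
      _ ≤ 2 * (B * B ^ (-⌊u⌋) * x + B * B ^ (-⌈u - p⌉) * y) := by gcongr
      _ = 2 * B * (B ^ (-⌊u⌋) * x + B ^ (-⌈u - p⌉) * y) := by ring
      _ ≤ 2 * B * (B / (B - 1) * (B ^ (-⌊u⌋) - B ^ (-⌊v⌋)) +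
          B / (B - 1) * (B ^ (-⌈u - p⌉) - B ^ (-⌈v - p⌉))) := by gcongr
      _ = _ := by ring
  refine le_trans (le_of_eq ?_) ((abs_add_le _ _).trans (add_le_add hD hA))
  congr 1
  ring

/-- Both sides of the one-step comparison telescope: the main term to a difference of values of the
bounded function `Ψ`, the error to `E 0 - E n ≤ E 0`. -/
theorem exists_abs_sum_fractIndicator_div_le {B p : ℝ} (hB : 1 < B) (h0 : 0 ≤ p) (h1 : p < 1) :
    ∃ C : ℝ, ∀ n : ℕ, |∑ d ∈ Finset.range n,
      (fractIndicator p (Real.logb B (2 * ((d : ℝ) + 1))) - p) / ((d : ℝ) + 1)| ≤ C := by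
  obtain ⟨C, hC, h⟩ := exists_abs_fractIndicator_div_le hB h0 h1
  have hB0 : 0 < B := by linarith
  have hlB : 0 < Real.log B := Real.log_pos hB
  refine ⟨C * 2 + 1 + Real.log B * 2, fun n => ?_⟩
  set u : ℕ → ℝ := fun d => Real.logb B (2 * ((d : ℝ) + 1)) with hu
  set Ψ : ℕ → ℝ := fun d => fractPrimitive p (u d) - p * u d with hΨ
  set E : ℕ → ℝ := fun d =>
    C * (B ^ (-⌊u d⌋) + B ^ (-⌈u d - p⌉)) + 1 / ((d : ℝ) + 1) with hE
  have hstep : ∀ d : ℕ, |(fractIndicator p (u d) - p) / ((d : ℝ) + 1) -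
      Real.log B * (Ψ (d + 1) - Ψ d)| ≤ E d - E (d + 1) := by
    intro d
    have := h ((d : ℝ) + 1) (by positivity)
    simp only [hΨ, hE, hu]
    push_cast
    refine this.trans (le_of_eq (by ring))
  have hu0 : 0 ≤ u 0 := Real.logb_nonneg hB (by norm_num)
  have hE0 : E 0 ≤ C * 2 + 1 := by
    have ha : B ^ (-⌊u 0⌋) ≤ 1 :=
      zpow_le_one_of_nonpos₀ hB.le (neg_nonpos.2 (Int.floor_nonneg.2 hu0))
    have hb : B ^ (-⌈u 0 - p⌉) ≤ 1 := by
      refine zpow_le_one_of_nonpos₀ hB.le (neg_nonpos.2 ?_)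
      have : (-1 : ℤ) < ⌈u 0 - p⌉ := Int.lt_ceil.2 (by push_cast; linarith)
      omega
    have hC2 := mul_le_mul_of_nonneg_left (add_le_add ha hb) hC
    simp only [hE, Nat.cast_zero, zero_add, div_one]
    linarith
  have hEn : 0 ≤ E n := by simp only [hE]; positivity
  have hΨ1 : ∀ d, |Ψ d| ≤ 1 := fun d => abs_fractPrimitive_sub_le h0 h1 _
  have hsum : |∑ d ∈ Finset.range n, ((fractIndicator p (u d) - p) / ((d : ℝ) + 1) -
      Real.log B * (Ψ (d + 1) - Ψ d))| ≤ E 0 - E n := by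
    refine (Finset.abs_sum_le_sum_abs _ _).trans ((Finset.sum_le_sum fun d _ => hstep d).trans ?_)
    rw [Finset.sum_range_sub']
  rw [Finset.sum_sub_distrib, ← Finset.mul_sum, Finset.sum_range_sub] at hsum
  have hT : |Real.log B * (Ψ n - Ψ 0)| ≤ Real.log B * 2 := by
    rw [abs_mul, abs_of_pos hlB]
    gcongr
    linarith [abs_sub (Ψ n) (Ψ 0), hΨ1 n, hΨ1 0]
  rw [abs_le] at hsum hT ⊢
  constructor <;> linarith [hsum.1, hsum.2, hT.1, hT.2]

/-- In terms of logarithms, the significand of `x` is at most `s` when the fractional part of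
`logb B x` is at most `logb B s`. -/
theorem significand_le_iff {B s x : ℝ} (hB : 1 < B) (hs : 0 < s) (hx : 0 < x) :
    significand B x ≤ s ↔ Int.fract (Real.logb B x) ≤ Real.logb B s := by
  have hB0 : 0 < B := by linarith
  have h : significand B x = B ^ Int.fract (Real.logb B x) := by
    rw [significand, ← Int.self_sub_floor, Real.rpow_sub hB0, Real.rpow_logb hB0 hB.ne' hx,
      Real.rpow_intCast]
  rw [h, ← Real.le_logb_iff_rpow_le hB hs]

/-! ### The law of the final collection -/

/-- The law of the collection after `N` levels, for an arbitrary starting collection. -/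
def runLevels (S : Set ℕ) : ℕ → List ℕ → PMF (List ℕ)
  | 0, a => PMF.pure a
  | N + 1, a => (levelStep S a).bind (runLevels S N)

/-- `levelLaw` adds levels at the end, whereas conditioning on the first cut needs them peeled off
at the front. -/
theorem runLevels_bind_levelStep (S : Set ℕ) (N : ℕ) (a : List ℕ) :
    (runLevels S N a).bind (levelStep S) = runLevels S (N + 1) a := by
  induction N generalizing a with
  | zero => simp [runLevels]
  | succ N ih =>
    rw [runLevels, PMF.bind_bind]
    simp_rw [ih]
    rfl

theorem levelLaw_eq_runLevels (S : Set ℕ) (L N : ℕ) : levelLaw S L N = runLevels S N [L] := by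
  induction N with
  | zero => rfl
  | succ N ih => rw [levelLaw, ih, runLevels_bind_levelStep]

theorem levelStep_singleton (S : Set ℕ) (n : ℕ) : levelStep S [n] = breakStick S n := by
  simp [levelStep, PMF.pure_map, PMF.bind_pure]

theorem levelStep_cons_of_mem {S : Set ℕ} {d : ℕ} (hd : d ∈ S) (a : List ℕ) :
    levelStep S (d :: a) = (levelStep S a).map (d :: ·) := by
  have : breakStick S d = PMF.pure [d] := by simp [breakStick, hd]
  rw [levelStep, this, PMF.pure_bind]
  rfl

theorem levelStep_append_of_mem {S : Set ℕ} {d : ℕ} (hd : d ∈ S) (a : List ℕ) :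
    levelStep S (a ++ [d]) = (levelStep S a).map (· ++ [d]) := by
  induction a with
  | nil => simp [levelStep_eq_pure, hd, levelStep, PMF.pure_map]
  | cons n a ih =>
    rw [List.cons_append, levelStep, levelStep, ih, PMF.map_bind]
    congr 1
    funext b
    rw [PMF.map_comp, PMF.map_comp]
    congr 1
    funext c
    simp

/-- A dead stick is inert. Versions at both ends of the list are needed, since the even piece comes
first or last according to the parity of the cut. -/
theorem runLevels_cons_of_mem {S : Set ℕ} {d : ℕ} (hd : d ∈ S) (N : ℕ) (a : List ℕ) :
    runLevels S N (d :: a) = (runLevels S N a).map (d :: ·) := by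
  induction N generalizing a with
  | zero => simp [runLevels, PMF.pure_map]
  | succ N ih =>
    rw [runLevels, runLevels, levelStep_cons_of_mem hd, PMF.bind_map, PMF.map_bind]
    congr 1
    funext b
    exact ih b

theorem runLevels_append_of_mem {S : Set ℕ} {d : ℕ} (hd : d ∈ S) (N : ℕ) (a : List ℕ) :
    runLevels S N (a ++ [d]) = (runLevels S N a).map (· ++ [d]) := by
  induction N generalizing a with
  | zero => simp [runLevels, PMF.pure_map]
  | succ N ih =>
    rw [runLevels, runLevels, levelStep_append_of_mem hd, PMF.bind_map, PMF.map_bind]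
    congr 1
    funext b
    exact ih b

theorem runLevels_of_mem {S : Set ℕ} {d : ℕ} (hd : d ∈ S) (N : ℕ) :
    runLevels S N [d] = PMF.pure [d] := by
  induction N with
  | zero => rfl
  | succ N ih => rw [runLevels, levelStep_eq_pure (by simpa using hd), PMF.pure_bind, ih]

theorem integrable_of_abs_le {μ : Measure (List ℕ)} [IsFiniteMeasure μ] {φ : List ℕ → ℝ} {C : ℝ}
    (hφ : ∀ a, |φ a| ≤ C) : Integrable φ μ :=
  Integrable.of_bound (measurable_from_top.aestronglyMeasurable) C (ae_of_all _ hφ)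

theorem integral_uniformOfFinset_bind {α : Type*} (s : Finset α) (hs : s.Nonempty)
    (g : α → PMF (List ℕ)) {φ : List ℕ → ℝ} {C : ℝ} (hφ : ∀ a, |φ a| ≤ C) :
    ∫ a, φ a ∂((PMF.uniformOfFinset s hs).bind g).toMeasure =
      (∑ j ∈ s, ∫ a, φ a ∂(g j).toMeasure) / s.card := by
  have h : ((PMF.uniformOfFinset s hs).bind g).toMeasure =
      (s.card : ENNReal)⁻¹ • ∑ j ∈ s, (g j).toMeasure := by
    ext t ht
    rw [PMF.toMeasure_bind_apply _ _ _ ht, tsum_eq_sum (s := s)]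
    · rw [Measure.smul_apply, Measure.finsetSum_apply, smul_eq_mul, Finset.mul_sum]
      exact Finset.sum_congr rfl fun j hj => by rw [PMF.uniformOfFinset_apply_of_mem hs hj]
    · intro j hj
      rw [PMF.uniformOfFinset_apply_of_notMem hs hj, zero_mul]
  rw [h, integral_smul_measure, integral_finsetSum_measure fun j _ => integrable_of_abs_le hφ]
  simp [div_eq_inv_mul]

theorem integral_map_toMeasure (p : PMF (List ℕ)) (g : List ℕ → List ℕ) (φ : List ℕ → ℝ) :
    ∫ a, φ a ∂(p.map g).toMeasure = ∫ a, φ (g a) ∂p.toMeasure := by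
  rw [← PMF.toMeasure_map g p measurable_from_top]
  exact integral_map measurable_from_top.aemeasurable measurable_from_top.aestronglyMeasurable

/-- Cut points of a stick of length `2 * n + 1` are sorted by parity and indexed so that `2 * m + 1`
and `2 * (n - m)` produce the same two pieces. -/
theorem sum_Icc_one_two_mul (F : ℕ → ℝ) (n : ℕ) :
    ∑ j ∈ Finset.Icc 1 (2 * n), F j =
      ∑ m ∈ Finset.range n, F (2 * m + 1) + ∑ m ∈ Finset.range n, F (2 * (n - m)) := by
  rw [show ∑ m ∈ Finset.range n, F (2 * (n - m)) = ∑ m ∈ Finset.range n, F (2 * m + 2) from ?_]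
  · induction n with
    | zero => simp
    | succ n ih =>
      rw [show 2 * (n + 1) = 2 * n + 1 + 1 by ring, Finset.sum_Icc_succ_top (by omega),
        Finset.sum_Icc_succ_top (by omega), ih, Finset.sum_range_succ, Finset.sum_range_succ]
      ring
  · rw [← Finset.sum_range_reflect fun m => F (2 * m + 2)]
    refine Finset.sum_congr rfl fun m hm => ?_
    have := Finset.mem_range.1 hm
    congr 1
    omega

theorem two_mul_mem_oneOrEven {m : ℕ} (hm : 0 < m) : 2 * m ∈ oneOrEven := Or.inr ⟨m, hm, rfl⟩

theorem odd_notMem_oneOrEven {m : ℕ} (hm : 0 < m) : 2 * m + 1 ∉ oneOrEven := by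
  rintro (h | ⟨k, -, h⟩)
  · have : 2 * m + 1 = 1 := h
    omega
  · omega

/-- The expectation of a bounded function of the collection after sufficiently many levels. -/
theorem integral_runLevels {N n : ℕ} (hn : n ≤ N) {φ : Multiset ℕ → ℝ} {C : ℝ}
    (hφ : ∀ s, |φ s| ≤ C) :
    ∫ a, φ a ∂(runLevels oneOrEven N [2 * n + 1]).toMeasure = chainExp n φ := by
  induction N generalizing n φ with
  | zero =>
    obtain rfl : n = 0 := by omega
    rw [runLevels, PMF.toMeasure_pure, integral_dirac]
    simp
  | succ N ih =>
    rcases n with _ | n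
    · rw [mul_zero, zero_add, runLevels_of_mem (Or.inl rfl), PMF.toMeasure_pure, integral_dirac]
      simp
    have hlive : ¬(2 * (n + 1) + 1 ∈ oneOrEven ∨ 2 * (n + 1) + 1 < 2) := by
      rintro (h | h)
      · exact odd_notMem_oneOrEven n.succ_pos h
      · omega
    rw [runLevels, levelStep_singleton, breakStick, dif_neg hlive, PMF.bind_map,
      integral_uniformOfFinset_bind _ _ _ fun a => hφ a, Nat.add_sub_cancel, sum_Icc_one_two_mul,
      chainExp_succ]
    have h1 : ∀ m ∈ Finset.range (n + 1), ∫ a, φ a ∂(((runLevels oneOrEven N ∘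
        fun j => [j, 2 * (n + 1) + 1 - j]) (2 * m + 1)).toMeasure) =
        chainExp m fun s => φ ((2 * (n + 1 - m)) ::ₘ s) := by
      intro m hm
      have hm := Finset.mem_range.1 hm
      rw [Function.comp_apply, show 2 * (n + 1) + 1 - (2 * m + 1) = 2 * (n + 1 - m) by omega,
        ← ih (by omega) fun s => hφ _]
      rw [show [2 * m + 1, 2 * (n + 1 - m)] = [2 * m + 1] ++ [2 * (n + 1 - m)] from rfl,
        runLevels_append_of_mem (two_mul_mem_oneOrEven (by omega)), integral_map_toMeasure]
      congr 1
      funext a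
      congr 1
      exact Multiset.coe_eq_coe.2 (List.perm_append_singleton _ _)
    have h2 : ∀ m ∈ Finset.range (n + 1), ∫ a, φ a ∂(((runLevels oneOrEven N ∘
        fun j => [j, 2 * (n + 1) + 1 - j]) (2 * (n + 1 - m))).toMeasure) =
        chainExp m fun s => φ ((2 * (n + 1 - m)) ::ₘ s) := by
      intro m hm
      have hm := Finset.mem_range.1 hm
      rw [Function.comp_apply, show 2 * (n + 1) + 1 - 2 * (n + 1 - m) = 2 * m + 1 by omega,
        ← ih (by omega) fun s => hφ _]
      rw [runLevels_cons_of_mem (two_mul_mem_oneOrEven (by omega)), integral_map_toMeasure]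
      rfl
    -- Odd and even cut points give equal sums, so the mean over `2 * (n + 1)` cuts is a mean over
    -- `n + 1` values of `m`.
    rw [Finset.sum_congr rfl h1, Finset.sum_congr rfl h2, ← two_mul, Nat.card_Icc]
    push_cast
    field_simp

/-! ### Strong Benford behavior -/

/-- The number of sticks with significand at most `s` is a sum of indicators. -/
theorem significandProportion_map_natCast {B s : ℝ} (hB : 1 < B) (hs : 1 ≤ s) (a : List ℕ) :
    significandProportion B s (a.map fun n : ℕ => (n : ℝ)) =
      ((a : Multiset ℕ).map fun n : ℕ => fractIndicator (Real.logb B s) (Real.logb B n)).sum /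
        (a : Multiset ℕ).card := by
  have hiff : ∀ n : ℕ, significand B n ≤ s ↔ Int.fract (Real.logb B n) ≤ Real.logb B s := by
    intro n
    rcases n.eq_zero_or_pos with rfl | hn
    -- For length `0` both sides hold, thanks to the default value `logb B 0 = 0`.
    · simp [significand, (zero_le_one.trans hs), Real.logb_nonneg hB hs]
    · exact significand_le_iff hB (by linarith) (by positivity)
  rw [significandProportion, List.length_map, Multiset.coe_card, Multiset.map_coe,
    Multiset.sum_coe]
  congr 1
  induction a with
  | nil => simp
  | cons n a ih =>
    rw [List.map_cons, List.countP_cons, Nat.cast_add, ih, List.map_cons, List.sum_cons, add_comm]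
    congr 1
    simp [fractIndicator, hiff]

theorem sum_map_sub_div_card (e : ℕ → ℝ) (p : ℝ) {s : Multiset ℕ} (hs : s ≠ 0) :
    (s.map e).sum / s.card - p = (s.map fun x => e x - p).sum / s.card := by
  have : (s.card : ℝ) ≠ 0 := by simpa using hs
  rw [Multiset.sum_map_sub]
  simp only [Multiset.map_const', Multiset.sum_replicate, nsmul_eq_mul]
  field_simp

/-- The mean square distance to a constant bounds the variance and the bias. -/
theorem variance_le_and_sq_integral_sub_le {μ : Measure (List ℕ)} [IsProbabilityMeasure μ]
    {X : List ℕ → ℝ} {C : ℝ} (hX : ∀ a, |X a| ≤ C) (p : ℝ) :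
    variance X μ ≤ ∫ a, (X a - p) ^ 2 ∂μ ∧ ((∫ a, X a ∂μ) - p) ^ 2 ≤ ∫ a, (X a - p) ^ 2 ∂μ := by
  have hsm : AEStronglyMeasurable X μ := measurable_from_top.aestronglyMeasurable
  have hL : MemLp (fun a => X a - p) 2 μ :=
    (MemLp.of_bound hsm C (ae_of_all _ hX)).sub (memLp_const p)
  have h1 : variance X μ = variance (fun a => X a - p) μ := (variance_sub_const hsm p).symm
  have h2 := variance_eq_sub hL
  have h3 : ∫ a, (X a - p) ∂μ = (∫ a, X a ∂μ) - p := by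
    rw [integral_sub (integrable_of_abs_le hX) (integrable_const p)]
    simp
  rw [h3] at h2
  have h4 := variance_nonneg X μ
  simp only [Pi.pow_apply] at h2
  -- The mean square distance to `p` is the variance plus the squared bias, both nonnegative.
  constructor <;> nlinarith [sq_nonneg ((∫ a, X a ∂μ) - p)]

theorem abs_significandProportion_le_one {B s : ℝ} (xs : List ℝ) :
    |significandProportion B s xs| ≤ 1 := by
  unfold significandProportion
  rw [abs_of_nonneg (by positivity)]
  exact div_le_one_of_le₀ (by exact_mod_cast List.countP_le_length) (Nat.cast_nonneg _)

/-- The mean square distance between the proportion and its Benford value, for a starting stick of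
odd length. -/
theorem exists_integral_significandProportion_sub_sq_le {B s : ℝ} (hB : 1 < B)
    (hs : s ∈ Set.Ico 1 B) :
    ∃ C : ℝ, ∀ n : ℕ, ∫ a, (significandProportion B s (a.map fun n : ℕ => (n : ℝ)) -
      Real.logb B s) ^ 2 ∂(finalLaw oneOrEven (2 * n + 1)).toMeasure ≤
        C / (1 + harmonicSum n) := by
  set p := Real.logb B s with hp
  have hp0 : 0 ≤ p := Real.logb_nonneg hB hs.1
  have hp1 : p < 1 := by
    rw [hp, Real.logb_lt_iff_lt_rpow hB (by linarith [hs.1]), Real.rpow_one]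
    exact hs.2
  obtain ⟨C, hC⟩ := exists_abs_sum_fractIndicator_div_le hB hp0 hp1
  set e : ℕ → ℝ := fun n => fractIndicator p (Real.logb B n) with he
  have he0 : ∀ x, |e x| ≤ 1 := fun x => by
    obtain ⟨h0, h1⟩ := fractIndicator_mem p (Real.logb B x)
    exact abs_le.2 ⟨by linarith, h1⟩
  have hf : ∀ x, |e x - p| ≤ 1 := fun x => by
    obtain ⟨h0, h1⟩ := fractIndicator_mem p (Real.logb B x)
    exact abs_le.2 ⟨by linarith, by linarith⟩
  -- The final stick of length `1` accounts for the extra `1`; the even sticks give the bounded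
  -- logarithmic sum.
  have hmean : ∀ n, |chainExp n fun t => (t.map fun x => e x - p).sum| ≤ 1 + C := by
    intro n
    rw [chainExp_sum]
    refine (abs_add_le _ _).trans (add_le_add (hf 1) ?_)
    simpa [he] using hC n
  refine ⟨4 + 4 * (1 + C), fun n => ?_⟩
  have hbound : ∀ t : Multiset ℕ, |((t.map e).sum / t.card - p) ^ 2| ≤ 4 := by
    intro t
    have h := abs_le.1 (abs_sum_map_div_card_le he0 t)
    rw [abs_of_nonneg (sq_nonneg _)]
    nlinarith [h.1, h.2]
  rw [finalLaw, levelLaw_eq_runLevels]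
  simp_rw [significandProportion_map_natCast hB hs.1, ← hp]
  rw [integral_runLevels (φ := fun t => ((t.map e).sum / t.card - p) ^ 2) (by omega) hbound,
    chainExp_congr n fun t ht => by rw [sum_map_sub_div_card e p ht]]
  exact chainExp_average_sq_le hf hmean n

end

theorem mainTheorem8 (B : ℝ) (hB : 1 < B) :
    ConvergesToStrongBenford (atTop ⊓ 𝓟 {L : ℕ | Odd L})
      (fun L : ℕ => (finalLaw oneOrEven L).toMeasure)
      (fun _ sticks => sticks.map fun n : ℕ => (n : ℝ)) B := by
  intro s hs
  obtain ⟨C, hC⟩ := exists_integral_significandProportion_sub_sq_le hB hs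
  have hlim : Tendsto (fun L : ℕ => C / (1 + harmonicSum (L / 2)))
      (atTop ⊓ 𝓟 {L : ℕ | Odd L}) (𝓝 0) := by
    have h1 : Tendsto harmonicSum atTop atTop := Real.tendsto_sum_range_one_div_nat_succ_atTop
    have h2 : Tendsto (fun L : ℕ => L / 2) atTop atTop := Nat.tendsto_div_const_atTop two_ne_zero
    exact ((tendsto_const_nhds.div_atTop
      (tendsto_atTop_add_const_left _ 1 (h1.comp h2)))).mono_left inf_le_left
  have hbound : ∀ᶠ L : ℕ in atTop ⊓ 𝓟 {L : ℕ | Odd L},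
      ∫ a, (significandProportion B s (a.map fun n : ℕ => (n : ℝ)) - Real.logb B s) ^ 2
        ∂(finalLaw oneOrEven L).toMeasure ≤ C / (1 + harmonicSum (L / 2)) := by
    refine Filter.mem_inf_of_right fun L hL => ?_
    obtain ⟨n, rfl⟩ := hL
    rw [Set.mem_ofPred_eq, show (2 * n + 1) / 2 = n by omega]
    exact hC n
  have hsq := fun L : ℕ => variance_le_and_sq_integral_sub_le
    (μ := (finalLaw oneOrEven L).toMeasure)
    (X := fun a => significandProportion B s (a.map fun n : ℕ => (n : ℝ)))
    (fun a => abs_significandProportion_le_one _) (Real.logb B s)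
  constructor
  · have h : Tendsto (fun L : ℕ => ((∫ a, significandProportion B s
        (a.map fun n : ℕ => (n : ℝ)) ∂(finalLaw oneOrEven L).toMeasure) - Real.logb B s) ^ 2)
        (atTop ⊓ 𝓟 {L : ℕ | Odd L}) (𝓝 0) :=
      tendsto_of_tendsto_of_tendsto_of_le_of_le' tendsto_const_nhds hlim
        (Eventually.of_forall fun L => sq_nonneg _)
        (hbound.mono fun L hL => (hsq L).2.trans hL)
    rw [tendsto_iff_norm_sub_tendsto_zero]
    simpa [Real.sqrt_sq_eq_abs] using h.sqrt
  · exact tendsto_of_tendsto_of_tendsto_of_le_of_le' tendsto_const_nhds hlim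
      (Eventually.of_forall fun L => variance_nonneg _ _)
      (hbound.mono fun L hL => (hsq L).1.trans hL)
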